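/- Let $\varphi:(0,\infty)\to[0,\infty)$ be a complete Bernstein function without killing and drift terms, i.e. $$\varphi(x)=\int_0^\infty (1-e^{-sx})\,\overline\nu(s)\,ds,\qquad x>0,$$ where $\overline\nu$ is completely monotone on $(0,\infty)$ and $\int_0^\infty (s\wedge 1)\,\overline\nu(s)\,ds<\infty$. Assume that $\varphi(\theta)\to 0$ and $\varphi(\theta)/\theta\to\infty$ as $\theta\to 0^+$, and that $\varphi(\theta)\to\infty$ and $\varphi(\theta)/\theta\to 0$ as $\theta\to\infty$. Let $\nu(x)=\int_x^\infty\overline\nu(z)\,dz$ for $x>0$, and let $\kappa:(0,\infty)\to[0,\infty)$ be an associate Sonine kernel of $\nu$, i.e. $\kappa$ is integrable on $(0,\varepsilon)$ for every $\varepsilon>0$ and $$\int_0^t\nu(z)\,\kappa(t-z)\,dz=1\qquad\text{for all } t>0.$$ Put $\chi(x)=\int_0^x\kappa(z)\,dz$ for $x\ge 0$, and assume that for every $\varepsilon>0$ (B1) $\kappa\in L^1(0,\varepsilon)\cap L^2(\varepsilon,\infty)$, (B2) $\chi\in L^2(0,\varepsilon)$. Let $W=(W_u)_{u\in\mathbb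 R}$ be a two-sided Wiener process on a probability space, that is, $(W_u)_{u\ge0}$ and $(W_{-u})_{u\ge0}$ are independent standard Brownian motions. For $t\ge 0$ let $$B^\kappa_t=\int_{\mathbb R}k(t,u)\,dW_u,\qquad k(t,u)=\sqrt{C_\kappa}\,\bigl[\chi((t-u)_+)-\chi((-u)_+)\bigr],\qquad C_\kappa=\Bigl(\int_{\mathbb R}\bigl[\chi((1-u)_+)-\chi((-u)_+)\bigr]^2du\Bigr)^{-1},$$ be the Wiener integral of $k(t,\cdot)$, which is $\sqrt{C_\kappa}$ times the generalized fractional integral $x\mapsto\int_x^\infty 1_{[0,t)}(y)\,\kappa(y-x)\,dy$ of $1_{[0,t)}$. Then $k(t,\cdot)\in L^2(\mathbb R)$ for every $t\ge 0$, so that the Wiener integrals are well defined, and with $$\rho_n=\mathbb E\bigl[B^\kappa_1\,(B^\kappa_{n+1}-B^\kappa_n)\bigr],\qquad n\ge 1,$$ one has $$\sum_{n=1}^{\infty}\rho_n=+\infty$$ (the partial sums tend to $+\infty$). In particular $\sum_{n=1}^\infty|\rho_n|=\infty$, i.e. the process $B^\kappa$ is long-range dependent. -/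

import Mathlib

open MeasureTheory ProbabilityTheory Set Filter Topology
open scoped NNReal ENNReal

noncomputable section

namespace BGM

/-! ### Complete Bernstein functions and Sonine kernels -/

/-- Complete monotonicity on the open half-line: smooth there, with derivatives of alternating
sign. -/
def IsCompletelyMonotone (f : ℝ → ℝ) : Prop :=
  ContDiffOn ℝ ((⊤ : ℕ∞) : WithTop ℕ∞) f (Ioi 0) ∧
    ∀ (k : ℕ) (x : ℝ), 0 < x → 0 ≤ (-1 : ℝ) ^ k * iteratedDerivWithin k f (Ioi 0) x

/-- `φ` is the complete Bernstein function without killing and drift terms whose Lévy measure has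
the completely monotone density `m`:
`φ x = ∫ (1 - exp (- s x)) m s ds` over `(0, ∞)`, where `∫ min s 1 * m s ds < ∞`. -/
structure IsCompleteBernstein (φ m : ℝ → ℝ) : Prop where
  density_cm : IsCompletelyMonotone m
  density_levy : IntegrableOn (fun s => min s 1 * m s) (Ioi 0)
  repr : ∀ x : ℝ, 0 < x → φ x = ∫ s in Ioi (0 : ℝ), (1 - Real.exp (-(s * x))) * m s

/-- The tail `ν x = ∫_x^∞ m z dz` of the Lévy measure with density `m`. -/
def levyTail (m : ℝ → ℝ) (x : ℝ) : ℝ := ∫ z in Ioi x, m z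

/-- Condition (C): `φ` tends to `0` at `0+` and to `∞` at `∞`. -/
def ConditionC (φ : ℝ → ℝ) : Prop :=
  Tendsto φ (𝓝[>] 0) (𝓝 0) ∧ Tendsto φ atTop atTop

/-- Condition (K): `φ θ / θ` tends to `∞` at `0+` and to `0` at `∞`. -/
def ConditionK (φ : ℝ → ℝ) : Prop :=
  Tendsto (fun θ => φ θ / θ) (𝓝[>] 0) atTop ∧ Tendsto (fun θ => φ θ / θ) atTop (𝓝 0)

/-- `κ` is an associate Sonine kernel of `ν`: it is non-negative on `(0, ∞)`, locally integrable
on `[0, ∞)`, and `∫_0^t ν z κ (t - z) dz = 1` for every `t > 0`. -/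
structure IsSonineKernel (ν κ : ℝ → ℝ) : Prop where
  nonneg : ∀ x : ℝ, 0 < x → 0 ≤ κ x
  locallyIntegrable : ∀ ε : ℝ, 0 < ε → IntegrableOn κ (Ioo 0 ε)
  sonine : ∀ t : ℝ, 0 < t → ∫ z in (0 : ℝ)..t, ν z * κ (t - z) = 1

/-- The primitive `χ x = ∫_0^x κ z dz`. -/
def chi (κ : ℝ → ℝ) (x : ℝ) : ℝ := ∫ z in (0 : ℝ)..x, κ z

/-- Condition (B1): `κ ∈ L¹(0, ε) ∩ L²(ε, ∞)` for every `ε > 0`. -/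
def ConditionB1 (κ : ℝ → ℝ) : Prop :=
  ∀ ε : ℝ, 0 < ε →
    MemLp κ 1 (volume.restrict (Ioo 0 ε)) ∧ MemLp κ 2 (volume.restrict (Ioi ε))

/-- Condition (B2): `χ ∈ L²(0, ε)` for every `ε > 0`. -/
def ConditionB2 (κ : ℝ → ℝ) : Prop :=
  ∀ ε : ℝ, 0 < ε → MemLp (chi κ) 2 (volume.restrict (Ioo 0 ε))

/-! ### The moving-average kernel -/

/-- The right-sided generalized fractional integral
`x ↦ ∫_x^∞ f t κ (t - x) dt`. -/
def fracIntegral (κ f : ℝ → ℝ) (x : ℝ) : ℝ := ∫ t in Ioi x, f t * κ (t - x)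

/-- `u ↦ χ ((t - u)₊) - χ ((-u)₊)`, the generalized fractional integral of the indicator function
of `[0, t)` (see `fracIntegral_indicator`). -/
def chiIncrement (κ : ℝ → ℝ) (t u : ℝ) : ℝ := chi κ (max (t - u) 0) - chi κ (max (-u) 0)

/-- The normalizing constant `C_κ`. -/
def normConst (κ : ℝ → ℝ) : ℝ := (∫ u : ℝ, chiIncrement κ 1 u ^ 2)⁻¹

/-- The Mandelbrot-Van Ness type kernel `√C_κ [χ ((t - u)₊) - χ ((-u)₊)]`. -/
def mvnKernel (κ : ℝ → ℝ) (t u : ℝ) : ℝ := √(normConst κ) * chiIncrement κ t u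

/-- `chiIncrement κ t` is the generalized fractional integral of the indicator of `[0, t)`. -/
theorem fracIntegral_indicator (κ : ℝ → ℝ)
    (hκ : ∀ ε : ℝ, 0 < ε → IntegrableOn κ (Ioo 0 ε)) (t : ℝ) (ht : 0 ≤ t) (u : ℝ) :
    fracIntegral κ ((Ico 0 t).indicator 1) u = chiIncrement κ t u := by
  have hint : ∀ c : ℝ, 0 ≤ c → IntervalIntegrable κ volume 0 c := by
    intro c hc
    rw [intervalIntegrable_iff_integrableOn_Ioc_of_le hc]
    exact (hκ (c + 1) (by linarith)).mono_set fun x hx => ⟨hx.1, by linarith [hx.2]⟩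
  have h1 : ∀ x, (Ico 0 t).indicator (1 : ℝ → ℝ) x * κ (x - u)
      = (Ico 0 t).indicator (fun x => κ (x - u)) x := by
    intro x
    by_cases hx : x ∈ Ico 0 t <;> simp [hx]
  have h3 : (Ioi u ∩ Ico 0 t : Set ℝ) =ᵐ[volume] (Ioc (max 0 u) (max t u) : Set ℝ) := by
    have h5 : Ioi u ∩ Ioc 0 t = Ioc (max 0 u) (max t u) := by
      ext x
      simp only [mem_inter_iff, mem_Ioi, mem_Ioc, max_lt_iff, le_max_iff]
      constructor
      · rintro ⟨a, b, c⟩; exact ⟨⟨b, a⟩, Or.inl c⟩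
      · rintro ⟨⟨b, a⟩, c | c⟩
        · exact ⟨a, b, c⟩
        · exact absurd a (not_lt.mpr c)
    rw [← h5]
    exact (ae_eq_refl (Ioi u)).inter Ico_ae_eq_Ioc
  have h2 : fracIntegral κ ((Ico 0 t).indicator 1) u
      = ∫ x in (max 0 u)..(max t u), κ (x - u) := by
    unfold fracIntegral
    simp_rw [h1]
    rw [setIntegral_indicator measurableSet_Ico, setIntegral_congr_set h3,
      intervalIntegral.integral_of_le (max_le_max ht le_rfl)]
  rw [h2, intervalIntegral.integral_comp_sub_right, ← max_sub_sub_right, ← max_sub_sub_right,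
    sub_self, zero_sub]
  unfold chiIncrement chi
  rw [intervalIntegral.integral_interval_sub_left (hint _ (le_max_right _ _))
    (hint _ (le_max_right _ _))]

/-! ### Wiener integrals with respect to a two-sided Wiener process -/

variable {Ω : Type*} [MeasurableSpace Ω]

/-- A two-sided Wiener process: `(W t)` and `(W (-t))`, `t ≥ 0`, are independent standard Brownian
motions. -/
structure IsTwoSidedWiener (W : ℝ → Ω → ℝ) (P : Measure Ω) : Prop where
  forward : IsBrownianReal (fun t : ℝ≥0 => W (t : ℝ)) P
  backward : IsBrownianReal (fun t : ℝ≥0 => W (-(t : ℝ))) P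
  indep : IndepFun (fun ω (t : ℝ≥0) => W (t : ℝ) ω) (fun ω (t : ℝ≥0) => W (-(t : ℝ)) ω) P

/-- The data of a step function `∑ i, c i • 1_(a i, b i]` on the real line. -/
structure StepData where
  size : ℕ
  coeff : Fin size → ℝ
  left : Fin size → ℝ
  right : Fin size → ℝ
  left_le_right : ∀ i, left i ≤ right i

/-- The step function. -/
def StepData.toFun (s : StepData) (u : ℝ) : ℝ :=
  ∑ i, s.coeff i * (Ioc (s.left i) (s.right i)).indicator (1 : ℝ → ℝ) u

/-- The elementary integral `∑ i, c i (W (b i) - W (a i))` of a step function. -/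
def StepData.integral (s : StepData) (W : ℝ → Ω → ℝ) (ω : Ω) : ℝ :=
  ∑ i, s.coeff i * (W (s.right i) ω - W (s.left i) ω)

/-- `X` is (a version of) the Wiener integral `∫ f dW` of `f ∈ L²(ℝ)`: it is the `L²(P)`-limit of
the elementary integrals of step functions that converge to `f` in `L²(ℝ)`. -/
structure IsWienerIntegral (P : Measure Ω) (W : ℝ → Ω → ℝ) (f : ℝ → ℝ) (X : Ω → ℝ) : Prop where
  memLp_integrand : MemLp f 2 volume
  memLp : MemLp X 2 P
  exists_approx : ∃ s : ℕ → StepData,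
    Tendsto (fun j => eLpNorm (fun u => (s j).toFun u - f u) 2 volume) atTop (𝓝 0) ∧
    Tendsto (fun j => eLpNorm (fun ω => (s j).integral W ω - X ω) 2 P) atTop (𝓝 0)

open Classical in
/-- The Wiener integral `∫ f dW` (determined up to almost sure equality). -/
def wienerIntegral (P : Measure Ω) (W : ℝ → Ω → ℝ) (f : ℝ → ℝ) : Ω → ℝ :=
  if h : ∃ X : Ω → ℝ, IsWienerIntegral P W f X then h.choose else 0

/-- The process `B_t^κ = ∫ √C_κ [χ ((t - u)₊) - χ ((-u)₊)] dW_u`. -/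
def processB (P : Measure Ω) (W : ℝ → Ω → ℝ) (κ : ℝ → ℝ) (t : ℝ) : Ω → ℝ :=
  wienerIntegral P W (mvnKernel κ t)

/-! ### Memory -/

/-- `ρ_n = E [B_1 (B_{n+1} - B_n)]`. -/
def rho (P : Measure Ω) (B : ℝ → Ω → ℝ) (n : ℕ) : ℝ :=
  ∫ ω, B 1 ω * (B ((n : ℝ) + 1) ω - B (n : ℝ) ω) ∂P

/-- Long-range dependence (long memory): the series `∑_{n ≥ 1} |ρ_n|` diverges. -/
def IsLongRangeDependent (P : Measure Ω) (B : ℝ → Ω → ℝ) : Prop :=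
  ¬ Summable (fun n : ℕ => |rho P B (n + 1)|)

end BGM

end

namespace BGM

/-! ### Covariance of a two-sided Wiener process and the elementary isometry -/

section Wiener

variable {Ω : Type*} [MeasurableSpace Ω] {P : Measure Ω} {W : ℝ → Ω → ℝ}

/-! The sum of the `ρ_n` telescopes: its `N`-th partial sum is `E[B_1 B_{N+1}] - E[B_1 ^ 2]`. By the
Wiener isometry this is the integral of `k(1,u) (k(N+1,u) - k(1,u))`. Since `κ ≥ 0`, `χ` is
nondecreasing and the integrand is nonnegative, so it may be restricted to `u ∈ (0, 1/2)`. There it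
is at least `C_κ χ(1/2) (χ(N) - χ(1))` (`le_integral_mvnKernel`), and everything reduces to `χ → ∞`.

That divergence comes from integrating the Sonine identity over `(0, T)`, which gives `T ≤ χ(T)
∫_0^T ν` (`le_chi_mul_integral`). As `ν` is integrable at `0`, decreasing and vanishes at infinity,
`∫_0^T ν = o(T)`, so `χ(T) → ∞`.

The remaining work is analytic groundwork: the Wiener integral exists and is isometric because step
functions are dense in `L²(ℝ)` and the elementary integral preserves inner products; and `k(t,·) ∈
L²` by Cauchy–Schwarz in the far past (`memLp_chiIncrement`). -/

theorem brownian_memLp {B : ℝ≥0 → Ω → ℝ} (hB : IsBrownianReal B P) (t : ℝ≥0) :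
    MemLp (B t) 2 P :=
  (hB.isGaussianProcess.hasGaussianLaw_eval t).memLp_two

theorem brownian_integral_mul [IsProbabilityMeasure P] {B : ℝ≥0 → Ω → ℝ}
    (hB : IsBrownianReal B P) (s t : ℝ≥0) :
    ∫ ω, B s ω * B t ω ∂P = min (s : ℝ) t := by
  have h := hB.covariance_eval s t
  rw [covariance_eq_sub (brownian_memLp hB s) (brownian_memLp hB t), hB.integral_eval,
    hB.integral_eval, mul_zero, sub_zero] at h
  simpa using h

theorem IsTwoSidedWiener.memLp (hW : IsTwoSidedWiener W P) (t : ℝ) : MemLp (W t) 2 P := by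
  rcases le_total 0 t with ht | ht
  · simpa [ht] using brownian_memLp hW.forward t.toNNReal
  · simpa [ht] using brownian_memLp hW.backward (-t).toNNReal

theorem min_eq_add_sub_abs_sub_div_two (s t : ℝ) : min s t = (s + t - |s - t|) / 2 := by
  rcases le_total s t with h | h
  · rw [min_eq_left h, abs_of_nonpos (by linarith)]
    ring
  · rw [min_eq_right h, abs_of_nonneg (by linarith)]
    ring

/-- One formula covers all signs: it is `min |s| |t|` for times on the same side of `0`, and `0` for
opposite sides, where independence and zero mean apply. -/
theorem IsTwoSidedWiener.integral_mul [IsProbabilityMeasure P] (hW : IsTwoSidedWiener W P)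
    (s t : ℝ) : ∫ ω, W s ω * W t ω ∂P = (|s| + |t| - |s - t|) / 2 := by
  have mixed : ∀ s t : ℝ, 0 ≤ s → t ≤ 0 →
      ∫ ω, W s ω * W t ω ∂P = (|s| + |t| - |s - t|) / 2 := by
    intro s t hs ht
    have hi : IndepFun (W s) (W t) P := by
      have hev : ∀ r : ℝ≥0, Measurable fun x : ℝ≥0 → ℝ => x r := measurable_pi_apply
      have := hW.indep.comp (hev s.toNNReal) (hev (-t).toNNReal)
      simpa [Function.comp_def, hs, ht] using this
    rw [hi.integral_fun_mul_eq_mul_integral (hW.memLp s).1 (hW.memLp t).1]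
    have := hW.forward.integral_eval s.toNNReal
    simp only [Real.coe_toNNReal _ hs] at this
    rw [this, abs_of_nonneg hs, abs_of_nonpos ht, abs_of_nonneg (by linarith)]
    ring
  rcases le_total 0 s with hs | hs <;> rcases le_total 0 t with ht | ht
  · have := brownian_integral_mul hW.forward s.toNNReal t.toNNReal
    simp only [Real.coe_toNNReal _ hs, Real.coe_toNNReal _ ht] at this
    rw [this, abs_of_nonneg hs, abs_of_nonneg ht, min_eq_add_sub_abs_sub_div_two]
  · exact mixed s t hs ht
  · have := mixed t s ht hs
    rw [abs_sub_comm s t, add_comm |s|, ← this]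
    exact integral_congr_ae (.of_forall fun ω => mul_comm _ _)
  · have := brownian_integral_mul hW.backward (-s).toNNReal (-t).toNNReal
    simp only [Real.coe_toNNReal _ (neg_nonneg.2 hs), Real.coe_toNNReal _ (neg_nonneg.2 ht),
      neg_neg] at this
    rw [this, abs_of_nonpos hs, abs_of_nonpos ht, min_eq_add_sub_abs_sub_div_two, neg_sub_neg,
      abs_sub_comm t s]

theorem IsTwoSidedWiener.integral_increment_mul [IsProbabilityMeasure P]
    (hW : IsTwoSidedWiener W P) (a b c d : ℝ) :
    ∫ ω, (W b ω - W a ω) * (W d ω - W c ω) ∂P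
      = (|b - c| + |a - d| - |b - d| - |a - c|) / 2 := by
  have hi : ∀ s t, Integrable (fun ω => W s ω * W t ω) P := fun s t =>
    (hW.memLp s).integrable_mul (hW.memLp t)
  have h : ∀ ω, (W b ω - W a ω) * (W d ω - W c ω)
      = (W b ω * W d ω - W b ω * W c ω) - (W a ω * W d ω - W a ω * W c ω) := fun ω => by ring
  simp_rw [h]
  rw [integral_sub (f := fun ω => W b ω * W d ω - W b ω * W c ω)
    (g := fun ω => W a ω * W d ω - W a ω * W c ω) ((hi _ _).sub (hi _ _)) ((hi _ _).sub (hi _ _)),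
    integral_sub (hi _ _) (hi _ _), integral_sub (hi _ _) (hi _ _)]
  simp_rw [hW.integral_mul]
  ring

/-- The length of the overlap, put in the form of `integral_increment_mul` so that the isometry can
be matched term by term. -/
theorem integral_indicator_Ioc_mul {a b c d : ℝ} (hab : a ≤ b) (hcd : c ≤ d) :
    ∫ u, (Ioc a b).indicator (1 : ℝ → ℝ) u * (Ioc c d).indicator (1 : ℝ → ℝ) u
      = (|b - c| + |a - d| - |b - d| - |a - c|) / 2 := by
  have h : ∀ u, (Ioc a b).indicator (1 : ℝ → ℝ) u * (Ioc c d).indicator (1 : ℝ → ℝ) u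
      = (Ioc (max a c) (min b d)).indicator (1 : ℝ → ℝ) u := by
    intro u
    rw [← Ioc_inter_Ioc, inter_indicator_one, Pi.mul_apply]
  simp_rw [h]
  rw [integral_indicator_one measurableSet_Ioc, Real.volume_real_Ioc]
  grind

theorem integral_sum_mul_sum {α : Type*} [MeasurableSpace α] {μ : Measure α} {ι κ : Type*}
    [Fintype ι] [Fintype κ] (c : ι → ℝ) (d : κ → ℝ) {X : ι → α → ℝ} {Y : κ → α → ℝ}
    (hX : ∀ i, MemLp (X i) 2 μ) (hY : ∀ j, MemLp (Y j) 2 μ) :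
    ∫ ω, (∑ i, c i * X i ω) * (∑ j, d j * Y j ω) ∂μ
      = ∑ i, ∑ j, c i * d j * ∫ ω, X i ω * Y j ω ∂μ := by
  have hi : ∀ i j, Integrable (fun ω => c i * d j * (X i ω * Y j ω)) μ := fun i j =>
    ((hX i).integrable_mul (hY j)).const_mul _
  have h : ∀ ω, (∑ i, c i * X i ω) * (∑ j, d j * Y j ω)
      = ∑ i, ∑ j, c i * d j * (X i ω * Y j ω) := fun ω => by
    rw [Finset.sum_mul_sum]
    exact Finset.sum_congr rfl fun i _ => Finset.sum_congr rfl fun j _ => by ring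
  simp_rw [h]
  rw [integral_finsetSum _ fun i _ => integrable_finsetSum _ fun j _ => hi i j]
  refine Finset.sum_congr rfl fun i _ => ?_
  rw [integral_finsetSum _ fun j _ => hi i j]
  exact Finset.sum_congr rfl fun j _ => integral_const_mul _ _

theorem memLp_indicator_Ioc (a b : ℝ) : MemLp ((Ioc a b).indicator (1 : ℝ → ℝ)) 2 volume :=
  memLp_indicator_const 2 measurableSet_Ioc 1 (.inr (by simp))

theorem StepData.memLp_toFun (s : StepData) : MemLp s.toFun 2 volume :=
  memLp_finsetSum (f := fun i u => s.coeff i * (Ioc (s.left i) (s.right i)).indicator 1 u) _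
    fun _ _ => (memLp_indicator_Ioc _ _).const_mul _

theorem StepData.memLp_integral (hW : IsTwoSidedWiener W P) (s : StepData) :
    MemLp (s.integral W) 2 P :=
  memLp_finsetSum (f := fun i ω => s.coeff i * (W (s.right i) ω - W (s.left i) ω)) _
    fun _ _ => ((hW.memLp _).sub (hW.memLp _)).const_mul _

theorem StepData.isometry [IsProbabilityMeasure P] (hW : IsTwoSidedWiener W P) (s r : StepData) :
    ∫ ω, s.integral W ω * r.integral W ω ∂P = ∫ u, s.toFun u * r.toFun u := by
  unfold StepData.integral StepData.toFun
  rw [integral_sum_mul_sum s.coeff r.coeff (X := fun i ω => W (s.right i) ω - W (s.left i) ω)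
    (Y := fun i ω => W (r.right i) ω - W (r.left i) ω)
    (fun i => (hW.memLp _).sub (hW.memLp _)) (fun i => (hW.memLp _).sub (hW.memLp _)),
    integral_sum_mul_sum s.coeff r.coeff (fun i => memLp_indicator_Ioc _ _)
      (fun i => memLp_indicator_Ioc _ _)]
  refine Finset.sum_congr rfl fun i _ => Finset.sum_congr rfl fun j _ => ?_
  rw [hW.integral_increment_mul,
    integral_indicator_Ioc_mul (s.left_le_right i) (r.left_le_right j)]

/-! ### Density of step functions -/

/-- Sample `g` at the right endpoints of a grid finer than its modulus of uniform continuity. The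
error vanishes off the box, which turns the uniform bound into an `L²` bound. -/
theorem exists_stepData_sub_le {g : ℝ → ℝ} (hg : Continuous g) (hs : HasCompactSupport g)
    {δ : ℝ} (hδ : 0 < δ) {M : ℕ} (hM : ∀ u, g u ≠ 0 → u ∈ Ioc (-M : ℝ) M) :
    ∃ s : StepData, ∀ u, |s.toFun u - g u| ≤ (Ioc (-M : ℝ) M).indicator (fun _ => δ) u := by
  obtain ⟨η, hη, hgη⟩ := Metric.uniformContinuous_iff.1
    (hg.uniformContinuous_of_tendsto_cocompact hs.is_zero_at_infty) δ hδ
  obtain ⟨n, hn⟩ := exists_nat_one_div_lt hη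
  set N : ℝ := (n : ℝ) + 1 with hN
  have hN0 : 0 < N := by positivity
  refine ⟨⟨2 * M * (n + 1), fun i => g (-M + (i + 1) / N), fun i => -M + i / N,
    fun i => -M + (i + 1) / N, fun i => by gcongr; linarith⟩, fun u => ?_⟩
  have hmem : ∀ i : ℕ, u ∈ Ioc (-M + i / N : ℝ) (-M + (i + 1) / N) ↔
      (i : ℝ) < (u + M) * N ∧ (u + M) * N ≤ i + 1 := by
    intro i
    rw [← div_lt_iff₀ hN0, ← le_div_iff₀ hN0, mem_Ioc]
    constructor <;> rintro ⟨h1, h2⟩ <;> constructor <;> linarith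
  unfold StepData.toFun
  simp only
  by_cases hu : u ∈ Ioc (-M : ℝ) M
  · have hpos : 0 < (u + M) * N := mul_pos (by linarith [hu.1]) hN0
    have hle : (u + M) * N ≤ (2 * M * (n + 1) : ℕ) := by
      push_cast
      rw [← hN]
      nlinarith [hu.2]
    have hj1 : 0 < ⌈(u + M) * N⌉₊ := Nat.ceil_pos.2 hpos
    have hj2 : ⌈(u + M) * N⌉₊ ≤ 2 * M * (n + 1) := Nat.ceil_le.2 hle
    obtain ⟨j, hj⟩ : ∃ j, ⌈(u + M) * N⌉₊ = j + 1 := ⟨_, (Nat.succ_pred_eq_of_pos hj1).symm⟩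
    -- The cells are disjoint: `u` lies only in the one with index `⌈(u + M) N⌉ - 1`.
    have key : ∀ i : ℕ, u ∈ Ioc (-M + i / N : ℝ) (-M + (i + 1) / N) ↔ i = j := by
      intro i
      rw [hmem]
      have := Nat.ceil_eq_iff (a := (u + M) * N) (n := i + 1) (by simp)
      rw [hj] at this
      push_cast at this
      rw [← this]
      omega
    rw [Finset.sum_eq_single ⟨j, by omega⟩]
    · have hm := (key j).2 rfl
      rw [indicator_of_mem hm, indicator_of_mem hu, Pi.one_apply, mul_one, ← Real.dist_eq]
      refine (hgη ?_).le
      rw [Real.dist_eq, abs_lt]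
      have : ((j : ℝ) + 1) / N = j / N + 1 / N := by ring
      constructor <;> linarith [hm.1, hm.2]
    · intro b _ hb
      rw [indicator_of_notMem, mul_zero]
      rw [key]
      exact fun h => hb (Fin.ext h)
    · simp
  · have hgu : g u = 0 := by
      by_contra h
      exact hu (hM u h)
    rw [Finset.sum_eq_zero, hgu, indicator_of_notMem hu]
    · simp
    · intro i _
      rw [indicator_of_notMem, mul_zero]
      rintro ⟨h1, h2⟩
      refine hu ⟨lt_of_le_of_lt (by simp; positivity) h1, h2.trans ?_⟩
      have hi : ((i : ℕ) : ℝ) + 1 ≤ 2 * M * N := by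
        have := i.2
        rw [hN]
        exact_mod_cast this
      have := (div_le_iff₀ hN0).2 hi
      linarith

theorem exists_stepData_eLpNorm_le {f : ℝ → ℝ} (hf : MemLp f 2 volume) {ε : ℝ≥0∞} (hε : ε ≠ 0) :
    ∃ s : StepData, eLpNorm (fun u => s.toFun u - f u) 2 volume ≤ ε := by
  have hε2 : ε / 2 ≠ 0 := by simpa using hε
  obtain ⟨g, hgs, hfg, hgc, hgm⟩ := hf.exists_hasCompactSupport_eLpNorm_sub_le (by simp) hε2
  obtain ⟨R, hR⟩ := hgs.isCompact.isBounded.subset_closedBall 0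
  obtain ⟨M, hM⟩ := exists_nat_gt R
  have hsup : ∀ u, g u ≠ 0 → u ∈ Ioc (-M : ℝ) M := by
    intro u hu
    have := hR (subset_tsupport g hu)
    rw [mem_closedBall_zero_iff, Real.norm_eq_abs, abs_le] at this
    exact ⟨by linarith, by linarith⟩
  have hC : volume (Ioc (-M : ℝ) M) ^ (1 / (2 : ℝ≥0∞).toReal) ≠ ∞ :=
    ENNReal.rpow_ne_top_of_nonneg (by positivity) (by simp)
  -- The `L²` error is `δ` times the square root of the length of the box, so `δ` is chosen after
  -- the box.
  obtain ⟨δ, hδ, hδC⟩ := ENNReal.exists_nnreal_pos_mul_lt hC hε2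
  obtain ⟨s, hs⟩ := exists_stepData_sub_le hgc hgs (δ := δ) (by exact_mod_cast hδ) hsup
  refine ⟨s, ?_⟩
  have h1 : eLpNorm (s.toFun - g) 2 volume ≤ ε / 2 := by
    refine (eLpNorm_mono_real (g := (Ioc (-M : ℝ) M).indicator (fun _ => (δ : ℝ))) hs).trans ?_
    rw [eLpNorm_indicator_const measurableSet_Ioc (by simp) (by simp)]
    refine le_trans (le_of_eq ?_) hδC.le
    simp
  have h2 : (fun u => s.toFun u - f u) = (s.toFun - g) + (g - f) := by ext u; simp
  rw [h2]
  refine (eLpNorm_add_le (s.memLp_toFun.sub hgm).1 (hgm.sub hf).1 (by simp)).trans ?_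
  rw [← ENNReal.add_halves ε, eLpNorm_sub_comm g f]
  exact add_le_add h1 hfg

theorem exists_stepData_tendsto {f : ℝ → ℝ} (hf : MemLp f 2 volume) :
    ∃ s : ℕ → StepData,
      Tendsto (fun j => eLpNorm (fun u => (s j).toFun u - f u) 2 volume) atTop (𝓝 0) := by
  choose s hs using fun j : ℕ => exists_stepData_eLpNorm_le hf
    (ε := ((j : ℝ≥0∞))⁻¹) (by simp)
  exact ⟨s, tendsto_of_tendsto_of_tendsto_of_le_of_le tendsto_const_nhds
    ENNReal.tendsto_inv_nat_nhds_zero (fun _ => zero_le) hs⟩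

/-! ### Existence and isometry of the Wiener integral -/

theorem inner_toLp {α : Type*} [MeasurableSpace α] {μ : Measure α} {f g : α → ℝ}
    (hf : MemLp f 2 μ) (hg : MemLp g 2 μ) :
    inner ℝ (hf.toLp f) (hg.toLp g) = ∫ x, f x * g x ∂μ := by
  rw [L2.inner_def]
  refine integral_congr_ae ?_
  filter_upwards [hf.coeFn_toLp, hg.coeFn_toLp] with x h1 h2
  rw [h1, h2]
  simp [mul_comm]

/-- The isometry makes the elementary integrals of an `L²`-convergent sequence of step functions
Cauchy in `L²(P)`. -/
theorem exists_isWienerIntegral [IsProbabilityMeasure P] (hW : IsTwoSidedWiener W P) {f : ℝ → ℝ}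
    (hf : MemLp f 2 volume) : ∃ X, IsWienerIntegral P W f X := by
  obtain ⟨s, hs⟩ := exists_stepData_tendsto hf
  have hF := (Lp.tendsto_Lp_iff_tendsto_eLpNorm'' (fun j => (s j).toFun)
    (fun j => (s j).memLp_toFun) f hf).2 hs
  -- Expanding the squared norm of a difference leaves only inner products, so differences of
  -- `StepData` need not be formed.
  have hdist : ∀ i j, dist (((s i).memLp_integral hW).toLp _) (((s j).memLp_integral hW).toLp _)
      = dist ((s i).memLp_toFun.toLp _) ((s j).memLp_toFun.toLp _) := by
    intro i j
    rw [dist_eq_norm, dist_eq_norm, ← sq_eq_sq₀ (norm_nonneg _) (norm_nonneg _),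
      norm_sub_sq_real, norm_sub_sq_real]
    simp only [← real_inner_self_eq_norm_sq, inner_toLp, StepData.isometry hW]
  have hC : CauchySeq fun j => ((s j).memLp_integral hW).toLp _ := by
    have := hF.cauchySeq
    rw [Metric.cauchySeq_iff] at this ⊢
    simpa only [hdist] using this
  obtain ⟨X, hX⟩ := cauchySeq_tendsto_of_complete hC
  have hX' : X = (Lp.memLp X).toLp X := (Lp.toLp_coeFn X _).symm
  rw [hX'] at hX
  exact ⟨X, hf, Lp.memLp X, s, hs, (Lp.tendsto_Lp_iff_tendsto_eLpNorm'' _ _ _ _).1 hX⟩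

theorem isWienerIntegral_wienerIntegral [IsProbabilityMeasure P] (hW : IsTwoSidedWiener W P)
    {f : ℝ → ℝ} (hf : MemLp f 2 volume) :
    IsWienerIntegral P W f (wienerIntegral P W f) := by
  have h := exists_isWienerIntegral hW hf
  rw [wienerIntegral, dif_pos h]
  exact h.choose_spec

/-- Both sides are limits of the same elementary inner products. The approximating sequences are
arbitrary, so the choice of version does not matter. -/
theorem IsWienerIntegral.integral_mul [IsProbabilityMeasure P] (hW : IsTwoSidedWiener W P)
    {f g : ℝ → ℝ} {X Y : Ω → ℝ} (hX : IsWienerIntegral P W f X) (hY : IsWienerIntegral P W g Y) :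
    ∫ ω, X ω * Y ω ∂P = ∫ u, f u * g u := by
  obtain ⟨s, hs, hsX⟩ := hX.exists_approx
  obtain ⟨r, hr, hrY⟩ := hY.exists_approx
  have h1 := ((Lp.tendsto_Lp_iff_tendsto_eLpNorm'' _ (fun j => (s j).memLp_toFun) f
    hX.memLp_integrand).2 hs).inner (𝕜 := ℝ) ((Lp.tendsto_Lp_iff_tendsto_eLpNorm'' _
      (fun j => (r j).memLp_toFun) g hY.memLp_integrand).2 hr)
  have h2 := ((Lp.tendsto_Lp_iff_tendsto_eLpNorm'' _ (fun j => (s j).memLp_integral hW) X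
    hX.memLp).2 hsX).inner (𝕜 := ℝ) ((Lp.tendsto_Lp_iff_tendsto_eLpNorm'' _
      (fun j => (r j).memLp_integral hW) Y hY.memLp).2 hrY)
  simp only [inner_toLp] at h1 h2
  simp only [StepData.isometry hW] at h2
  exact tendsto_nhds_unique h2 h1

end Wiener

/-! ### The primitive of a Sonine kernel -/

section Chi

variable {ν κ : ℝ → ℝ}

theorem IsSonineKernel.integrableOn_Ioc (h : IsSonineKernel ν κ) {a b : ℝ} (ha : 0 ≤ a) :
    IntegrableOn κ (Ioc a b) := by
  rcases le_total b 0 with hb | hb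
  · rw [Ioc_eq_empty (by linarith)]
    exact integrableOn_empty
  · exact (h.locallyIntegrable (b + 1) (by linarith)).mono_set fun x hx =>
      ⟨ha.trans_lt hx.1, by linarith [hx.2]⟩

theorem IsSonineKernel.intervalIntegrable (h : IsSonineKernel ν κ) {a b : ℝ} (ha : 0 ≤ a)
    (hab : a ≤ b) : IntervalIntegrable κ volume a b :=
  (intervalIntegrable_iff_integrableOn_Ioc_of_le hab).2 (h.integrableOn_Ioc ha)

theorem IsSonineKernel.chi_sub (h : IsSonineKernel ν κ) {a b : ℝ} (ha : 0 ≤ a) (hab : a ≤ b) :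
    chi κ b - chi κ a = ∫ z in a..b, κ z :=
  intervalIntegral.integral_interval_sub_left (h.intervalIntegrable le_rfl (ha.trans hab))
    (h.intervalIntegrable le_rfl ha)

theorem IsSonineKernel.chi_mono (h : IsSonineKernel ν κ) {a b : ℝ} (ha : 0 ≤ a) (hab : a ≤ b) :
    chi κ a ≤ chi κ b := by
  rw [← sub_nonneg, h.chi_sub ha hab, intervalIntegral.integral_of_le hab]
  exact setIntegral_nonneg measurableSet_Ioc fun x hx => h.nonneg x (ha.trans_lt hx.1)

theorem chi_zero (κ : ℝ → ℝ) : chi κ 0 = 0 := intervalIntegral.integral_same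

theorem IsSonineKernel.chi_nonneg (h : IsSonineKernel ν κ) {a : ℝ} (ha : 0 ≤ a) :
    0 ≤ chi κ a := (chi_zero κ).symm.trans_le (h.chi_mono le_rfl ha)

theorem IsSonineKernel.integral_comp_sub_mul (h : IsSonineKernel ν κ) {t : ℝ} (ht : 0 < t) :
    ∫ y in (0 : ℝ)..t, ν (t - y) * κ y = 1 := by
  have := intervalIntegral.integral_comp_sub_left (a := 0) (b := t)
    (fun y => ν (t - y) * κ y) t
  simp only [sub_sub_cancel, sub_self, sub_zero] at this
  rw [← this, h.sonine t ht]

/-- Otherwise `κ = 0` almost everywhere on `(0, t)`, and the Sonine integral would be `0` instead of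
`1`. -/
theorem IsSonineKernel.chi_pos (h : IsSonineKernel ν κ) {t : ℝ} (ht : 0 < t) : 0 < chi κ t := by
  refine (h.chi_nonneg ht.le).lt_of_ne fun h0 => ?_
  have h1 := h.integral_comp_sub_mul ht
  rw [chi, intervalIntegral.integral_of_le ht.le, eq_comm, setIntegral_eq_zero_iff_of_nonneg_ae
    (ae_restrict_of_forall_mem measurableSet_Ioc fun x hx => h.nonneg x hx.1)
    (h.integrableOn_Ioc le_rfl)] at h0
  rw [intervalIntegral.integral_of_le ht.le, setIntegral_congr_ae (g := fun _ => 0)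
    measurableSet_Ioc] at h1
  · simp at h1
  · have := (ae_restrict_iff' measurableSet_Ioc).1 h0
    filter_upwards [this] with x hx hxt
    rw [hx hxt, Pi.zero_apply, mul_zero]

/-- Truncate both kernels to `(0, T)`. Their convolution still equals `1` on `(0, T)`, is
nonnegative elsewhere, and has total mass equal to the product of the two masses. -/
theorem IsSonineKernel.le_chi_mul_integral (h : IsSonineKernel ν κ) (hν : ∀ x, 0 < x → 0 ≤ ν x)
    {T : ℝ} (hT : 0 < T) (hi : IntegrableOn ν (Ioo 0 T)) :
    T ≤ chi κ T * ∫ z in Ioo 0 T, ν z := by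
  set K := (Ioo 0 T).indicator κ
  set N := (Ioo 0 T).indicator ν
  have hK : Integrable K := (h.locallyIntegrable T hT).integrable_indicator measurableSet_Ioo
  have hN : Integrable N := hi.integrable_indicator measurableSet_Ioo
  have hK0 : ∀ x, 0 ≤ K x := fun x => indicator_nonneg (fun y hy => h.nonneg y hy.1) x
  have hN0 : ∀ x, 0 ≤ N x := fun x => indicator_nonneg (fun y hy => hν y hy.1) x
  have hconv := hK.integrable_convolution (ContinuousLinearMap.mul ℝ ℝ) hN
  have hint := integral_convolution (ContinuousLinearMap.mul ℝ ℝ) hK hN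
  have hone : ∀ t ∈ Ioo 0 T,
      MeasureTheory.convolution K N (ContinuousLinearMap.mul ℝ ℝ) volume t = 1 := by
    intro t ht
    rw [← h.integral_comp_sub_mul ht.1, intervalIntegral.integral_of_le ht.1.le,
      integral_Ioc_eq_integral_Ioo, ← integral_indicator measurableSet_Ioo]
    refine integral_congr_ae (.of_forall fun y => ?_)
    simp only [K, N, ContinuousLinearMap.mul_apply', indicator, mem_Ioo]
    have := ht.1
    have := ht.2
    grind
  have h1 : ∫ t in Ioo 0 T, MeasureTheory.convolution K N (ContinuousLinearMap.mul ℝ ℝ) volume t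
      = T := by
    rw [setIntegral_congr_fun measurableSet_Ioo hone]
    simp [hT.le]
  have h2 : ∫ x, K x = chi κ T := by
    rw [integral_indicator measurableSet_Ioo, chi, intervalIntegral.integral_of_le hT.le,
      integral_Ioc_eq_integral_Ioo]
  have h3 : ∫ x, N x = ∫ z in Ioo 0 T, ν z := integral_indicator measurableSet_Ioo
  rw [h2, h3, ContinuousLinearMap.mul_apply'] at hint
  rw [← hint]
  nth_rewrite 1 [← h1]
  exact setIntegral_le_integral hconv (.of_forall fun x =>
    integral_nonneg fun y => mul_nonneg (hK0 _) (hN0 _))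

/-- The primitive of an associate Sonine kernel of a decreasing integrable-at-zero kernel that
vanishes at infinity is unbounded. -/
theorem IsSonineKernel.tendsto_chi (h : IsSonineKernel ν κ) (hν : ∀ x, 0 < x → 0 ≤ ν x)
    (hanti : AntitoneOn ν (Ioi 0)) (hi : IntegrableOn ν (Ioo 0 1))
    (hlim : Tendsto ν atTop (𝓝 0)) : Tendsto (chi κ) atTop atTop := by
  have hii : ∀ a T, 0 < a → IntegrableOn ν (Icc a T) := fun a T ha =>
    (hanti.mono fun x hx => ha.trans_le hx.1).integrableOn_isCompact isCompact_Icc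
  have hiT : ∀ T, IntegrableOn ν (Ioo 0 T) := fun T =>
    (hi.union (hii 1 T one_pos)).mono_set fun x hx => by
      rcases lt_or_ge x 1 with h1 | h1
      · exact .inl ⟨hx.1, h1⟩
      · exact .inr ⟨h1, hx.2.le⟩
  rw [tendsto_atTop]
  intro M
  wlog hM : 0 < M generalizing M
  · exact (this 1 one_pos).mono fun x hx => by linarith
  have hε : 0 < 1 / (2 * M) := by positivity
  -- Beyond `A` the kernel `ν` contributes at most `T / (2M)`; for large `T` so does the fixed mass
  -- on `(0, A)`. Hence `T ≤ χ(T) T / M`.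
  obtain ⟨A, hA0, hA⟩ : ∃ A : ℝ, 0 < A ∧ ν A < 1 / (2 * M) :=
    ((eventually_gt_atTop 0).and (hlim.eventually_lt_const hε)).exists
  filter_upwards [eventually_ge_atTop A,
    eventually_ge_atTop ((∫ z in Ioo 0 A, ν z) * (2 * M))] with T hTA hT
  have hT0 : 0 < T := hA0.trans_le hTA
  have hsplit : ∫ z in Ioo 0 T, ν z ≤ T / M := by
    have hu : Ioo 0 T = Ioo 0 A ∪ Ico A T := (Ioo_union_Ico_eq_Ioo hA0 hTA).symm
    have hIco : IntegrableOn ν (Ico A T) := (hii A T hA0).mono_set Ico_subset_Icc_self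
    rw [hu, setIntegral_union (by
      rw [Set.disjoint_left]; intro x hx hx'; linarith [hx.2, hx'.1]) measurableSet_Ico (hiT A) hIco]
    have h1 : ∫ z in Ico A T, ν z ≤ ∫ _ in Ico A T, 1 / (2 * M) :=
      setIntegral_mono_on hIco (integrableOn_const (by simp)) measurableSet_Ico fun x hx =>
        (hanti hA0 (hA0.trans_le hx.1) hx.1).trans hA.le
    have h2 : ∫ _ in Ico A T, 1 / (2 * M) = (T - A) * (1 / (2 * M)) := by
      simp [hTA]
    have h3 : ∫ z in Ioo 0 A, ν z ≤ T * (1 / (2 * M)) := by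
      rw [mul_one_div, le_div_iff₀ (by positivity)]
      exact hT
    have h4 : T / M = T * (1 / (2 * M)) + T * (1 / (2 * M)) := by
      field_simp
      norm_num
    nlinarith [mul_pos hA0 hε]
  have := (h.le_chi_mul_integral hν hT0 (hiT T)).trans
    (mul_le_mul_of_nonneg_left hsplit (h.chi_nonneg hT0.le))
  rw [mul_div_assoc', le_div_iff₀ hM, mul_comm T] at this
  exact le_of_mul_le_mul_right this hT0

end Chi

/-! ### The tail of the Lévy measure -/

section LevyTail

variable {φ m : ℝ → ℝ}

theorem IsCompleteBernstein.density_nonneg (h : IsCompleteBernstein φ m) {x : ℝ} (hx : 0 < x) :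
    0 ≤ m x := by
  simpa using h.density_cm.2 0 x hx

/-- Away from `0` the Lévy weight `min z 1` is bounded below by `min x 1`. -/
theorem IsCompleteBernstein.integrableOn_Ioi (h : IsCompleteBernstein φ m) {x : ℝ} (hx : 0 < x) :
    IntegrableOn m (Ioi x) := by
  have hmeas : AEStronglyMeasurable m (volume.restrict (Ioi x)) :=
    (h.density_cm.1.continuousOn.mono (Ioi_subset_Ioi hx.le)).aestronglyMeasurable
      measurableSet_Ioi
  have hd := (h.density_levy.mono_set (Ioi_subset_Ioi hx.le)).const_mul (min x 1)⁻¹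
  refine hd.mono' hmeas (ae_restrict_of_forall_mem measurableSet_Ioi fun z (hz : x < z) => ?_)
  have hm := h.density_nonneg (hx.trans hz)
  have hmin : 0 < min x 1 := lt_min hx one_pos
  rw [Real.norm_eq_abs, abs_of_nonneg hm, ← mul_assoc]
  refine le_mul_of_one_le_left hm ?_
  rw [inv_mul_eq_div, one_le_div hmin]
  exact min_le_min_right 1 hz.le

theorem IsCompleteBernstein.levyTail_nonneg (h : IsCompleteBernstein φ m) (x : ℝ) (hx : 0 < x) :
    0 ≤ levyTail m x :=
  setIntegral_nonneg measurableSet_Ioi fun _ hz => h.density_nonneg (hx.trans hz)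

theorem IsCompleteBernstein.levyTail_antitoneOn (h : IsCompleteBernstein φ m) :
    AntitoneOn (levyTail m) (Ioi 0) := fun x (hx : 0 < x) _ _ hxy =>
  setIntegral_mono_set (h.integrableOn_Ioi hx)
    (ae_restrict_of_forall_mem measurableSet_Ioi fun _ hz => h.density_nonneg (hx.trans hz))
    (Ioi_subset_Ioi hxy).eventuallyLE

theorem IsCompleteBernstein.levyTail_tendsto (h : IsCompleteBernstein φ m) :
    Tendsto (levyTail m) atTop (𝓝 0) := by
  have h1 := intervalIntegral_tendsto_integral_Ioi 1 (h.integrableOn_Ioi one_pos) tendsto_id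
  have h2 := h1.const_sub (levyTail m 1)
  rw [levyTail, sub_self] at h2
  refine h2.congr' ?_
  filter_upwards [eventually_ge_atTop 1] with x hx
  rw [id, ← intervalIntegral.integral_Ioi_sub_Ioi (h.integrableOn_Ioi one_pos) hx, sub_sub_cancel]
  rfl

/-- Tonelli: integrating the tail over `(0, 1)` gives `∫ min z 1 * m z dz`, exactly the Lévy
integrability condition. -/
theorem IsCompleteBernstein.levyTail_integrableOn (h : IsCompleteBernstein φ m) :
    IntegrableOn (levyTail m) (Ioo 0 1) := by
  have hm : AEStronglyMeasurable m (volume.restrict (Ioi 0)) :=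
    h.density_cm.1.continuousOn.aestronglyMeasurable measurableSet_Ioi
  set F : ℝ × ℝ → ℝ := {p : ℝ × ℝ | p.1 < p.2}.indicator fun p => m p.2
  have hset : MeasurableSet {p : ℝ × ℝ | p.1 < p.2} := measurableSet_lt measurable_fst measurable_snd
  have hF : AEStronglyMeasurable F
      ((volume.restrict (Ioo (0 : ℝ) 1)).prod (volume.restrict (Ioi (0 : ℝ)))) :=
    (hm.comp_snd).indicator hset
  have hint : Integrable F
      ((volume.restrict (Ioo (0 : ℝ) 1)).prod (volume.restrict (Ioi (0 : ℝ)))) := by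
    rw [integrable_prod_iff' hF]
    have hFz : ∀ z : ℝ, (fun x => F (x, z)) = (Iio z).indicator fun _ => m z := by
      intro z
      ext x
      simp [F, indicator]
    constructor
    · refine .of_forall fun z => ?_
      rw [hFz]
      exact (integrable_const _).indicator measurableSet_Iio
    · refine h.density_levy.congr (ae_restrict_of_forall_mem measurableSet_Ioi fun z hz => ?_)
      have h1 : (fun x => ‖F (x, z)‖) = (Iio z).indicator fun _ => m z := by
        ext x
        rw [congrFun (hFz z) x, norm_indicator_eq_indicator_norm, Real.norm_eq_abs,
          abs_of_nonneg (h.density_nonneg hz)]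
      simp only
      rw [h1, integral_indicator measurableSet_Iio, Measure.restrict_restrict measurableSet_Iio,
        setIntegral_const, inter_comm, Ioo_inter_Iio, Real.volume_real_Ioo, sub_zero,
        max_eq_left (le_min zero_le_one (le_of_lt hz)), smul_eq_mul, min_comm]
  refine hint.integral_prod_left.congr (ae_restrict_of_forall_mem measurableSet_Ioo fun x hx => ?_)
  have : (fun z => F (x, z)) = (Ioi x).indicator m := by
    ext z
    simp [F, indicator]
  simp only
  rw [this, integral_indicator measurableSet_Ioi, Measure.restrict_restrict measurableSet_Ioi,
    inter_eq_left.2 (Ioi_subset_Ioi hx.1.le)]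
  rfl

theorem IsCompleteBernstein.tendsto_chi (h : IsCompleteBernstein φ m) {κ : ℝ → ℝ}
    (hκ : IsSonineKernel (levyTail m) κ) : Tendsto (chi κ) atTop atTop :=
  hκ.tendsto_chi h.levyTail_nonneg h.levyTail_antitoneOn h.levyTail_integrableOn
    h.levyTail_tendsto

end LevyTail

/-! ### The moving-average kernel -/

section Kernel

variable {ν κ : ℝ → ℝ}

/-- Monotonicity in `u` yields Borel measurability of the kernel. -/
theorem IsSonineKernel.antitone_chi_max (h : IsSonineKernel ν κ) (t : ℝ) :
    Antitone fun u => chi κ (max (t - u) 0) := fun _ _ huv =>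
  h.chi_mono (le_max_right _ _) (max_le_max_right 0 (by linarith))

theorem IsSonineKernel.measurable_chiIncrement (h : IsSonineKernel ν κ) (t : ℝ) :
    Measurable (chiIncrement κ t) := by
  have := (h.antitone_chi_max 0).measurable
  simp only [zero_sub] at this
  exact (h.antitone_chi_max t).measurable.sub this

theorem IsSonineKernel.chiIncrement_mono (h : IsSonineKernel ν κ) {s t : ℝ} (hst : s ≤ t) (u : ℝ) :
    chiIncrement κ s u ≤ chiIncrement κ t u :=
  sub_le_sub_right (h.chi_mono (le_max_right _ _) (max_le_max_right 0 (by linarith))) _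

theorem chiIncrement_zero (κ : ℝ → ℝ) (u : ℝ) : chiIncrement κ 0 u = 0 := by
  simp [chiIncrement]

theorem IsSonineKernel.chiIncrement_nonneg (h : IsSonineKernel ν κ) {t : ℝ} (ht : 0 ≤ t) (u : ℝ) :
    0 ≤ chiIncrement κ t u :=
  (chiIncrement_zero κ u).symm.trans_le (h.chiIncrement_mono ht u)

/-- Cauchy–Schwarz, by integrating `2 c f ≤ f ^ 2 + c ^ 2` with `c` the mean of `f`. -/
theorem sq_intervalIntegral_le {f : ℝ → ℝ} {a b : ℝ} (hab : a < b)
    (hf : IntervalIntegrable f volume a b) (hf2 : IntervalIntegrable (fun x => f x ^ 2) volume a b) :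
    (∫ x in a..b, f x) ^ 2 ≤ (b - a) * ∫ x in a..b, f x ^ 2 := by
  have hL : 0 < b - a := sub_pos.2 hab
  set I := ∫ x in a..b, f x
  have h := intervalIntegral.integral_mono_on hab.le (hf.const_mul (2 * (I / (b - a))))
    (hf2.add (intervalIntegrable_const (c := (I / (b - a)) ^ 2)))
    fun x _ => by nlinarith [sq_nonneg (f x - I / (b - a))]
  rw [intervalIntegral.integral_const_mul, intervalIntegral.integral_add hf2
    intervalIntegrable_const, intervalIntegral.integral_const, smul_eq_mul] at h
  have h1 : 2 * (I / (b - a)) * I = 2 * (I ^ 2 / (b - a)) := by ring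
  have h2 : (b - a) * (I / (b - a)) ^ 2 = I ^ 2 / (b - a) := by field_simp
  rw [mul_comm (b - a), ← div_le_iff₀ hL]
  change 2 * (I / (b - a)) * I ≤ _ at h
  linarith

/-- The sliding-window integral is the convolution of `h` with the indicator of `[-t, 0)`. -/
theorem integrable_intervalIntegral_add {h : ℝ → ℝ} (hh : Integrable h) {t : ℝ} (ht : 0 ≤ t) :
    Integrable fun x => ∫ z in x..(x + t), h z := by
  have h1 : Integrable ((Ico (-t) 0).indicator (1 : ℝ → ℝ)) :=
    (integrable_indicator_iff measurableSet_Ico).2 (integrableOn_const (C := (1 : ℝ)) (by simp))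
  refine (h1.integrable_convolution (ContinuousLinearMap.mul ℝ ℝ) hh).congr
    (.of_forall fun x => ?_)
  have h2 := intervalIntegral.integral_comp_sub_left (a := -t) (b := 0) h x
  rw [sub_zero, sub_neg_eq_add] at h2
  simp only
  rw [← h2, intervalIntegral.integral_of_le (by linarith), ← integral_Ico_eq_integral_Ioc,
    ← integral_indicator measurableSet_Ico]
  refine integral_congr_ae (.of_forall fun y => ?_)
  by_cases hy : y ∈ Ico (-t) 0 <;> simp [hy]

/-- Three ranges: the kernel vanishes for `u > t`, is at most `χ(t + 1)` for `-1 < u ≤ t`, and for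
`u ≤ -1` is the integral of `κ` over a window of length `t` inside `(1, ∞)`, where Cauchy–Schwarz
and `κ ∈ L²(1, ∞)` apply. -/
theorem IsSonineKernel.memLp_chiIncrement (h : IsSonineKernel ν κ) (hB1 : ConditionB1 κ)
    {t : ℝ} (ht : 0 ≤ t) : MemLp (chiIncrement κ t) 2 volume := by
  rcases ht.eq_or_lt with rfl | ht0
  · have : chiIncrement κ 0 = 0 := funext (chiIncrement_zero κ)
    rw [this]
    exact MemLp.zero
  have hsqOn : IntegrableOn (fun x => κ x ^ 2) (Ioi 1) := (hB1 1 one_pos).2.integrable_sq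
  have hsq := hsqOn.integrable_indicator measurableSet_Ioi
  have hfar := ((integrable_intervalIntegral_add hsq ht).comp_neg).const_mul t
  have hnear : Integrable ((Ioc (-1) t).indicator fun _ : ℝ => chi κ (t + 1) ^ 2) :=
    (integrable_indicator_iff measurableSet_Ioc).2 (by simp)
  have hmeas := h.measurable_chiIncrement t
  rw [memLp_two_iff_integrable_sq hmeas.aestronglyMeasurable]
  refine (hnear.add hfar).mono' (hmeas.pow_const 2).aestronglyMeasurable (.of_forall fun u => ?_)
  have hfar0 : 0 ≤ t * ∫ z in (-u)..(-u + t), (Ioi 1).indicator (fun x => κ x ^ 2) z :=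
    mul_nonneg ht (intervalIntegral.integral_nonneg (by linarith) fun z _ =>
      indicator_nonneg (fun _ _ => sq_nonneg _) z)
  have hnear0 : 0 ≤ (Ioc (-1) t).indicator (fun _ : ℝ => chi κ (t + 1) ^ 2) u :=
    indicator_nonneg (fun _ _ => sq_nonneg _) u
  rw [Real.norm_eq_abs, abs_of_nonneg (sq_nonneg _), Pi.add_apply]
  have hnn := h.chiIncrement_nonneg ht u
  rcases lt_or_ge t u with hu | hu
  · have : chiIncrement κ t u = 0 := by
      rw [chiIncrement, max_eq_right (by linarith), max_eq_right (by linarith), sub_self]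
    rw [this]
    simpa using add_nonneg hnear0 hfar0
  rcases lt_or_ge (-1) u with hu1 | hu1
  · refine le_trans ?_ (le_add_of_nonneg_right hfar0)
    rw [indicator_of_mem (show u ∈ Ioc (-1) t from ⟨hu1, hu⟩)]
    refine pow_le_pow_left₀ hnn ?_ 2
    have h1 := h.chi_nonneg (le_max_right (-u) 0)
    have h2 := h.chi_mono (le_max_right (t - u) 0) (max_le (by linarith) (by linarith) :
      max (t - u) 0 ≤ t + 1)
    rw [chiIncrement]
    linarith
  · refine le_trans ?_ (le_add_of_nonneg_left hnear0)
    have hle : -u ≤ -u + t := by linarith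
    have hsub : Ioc (-u) (-u + t) ⊆ Ioi 1 := fun z hz => by
      have := hz.1
      simp only [mem_Ioi]
      linarith
    have h2 : IntervalIntegrable (fun x => κ x ^ 2) volume (-u) (-u + t) :=
      (intervalIntegrable_iff_integrableOn_Ioc_of_le hle).2
        (hsqOn.mono_set hsub)
    have h3 := sq_intervalIntegral_le (by linarith)
      (h.intervalIntegrable (by linarith) hle) h2
    have h4 : chiIncrement κ t u = ∫ z in (-u)..(-u + t), κ z := by
      rw [← h.chi_sub (by linarith) hle, chiIncrement, max_eq_left (by linarith),
        max_eq_left (by linarith), neg_add_eq_sub]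
    have h5 : ∫ z in (-u)..(-u + t), (Ioi 1).indicator (fun x => κ x ^ 2) z
        = ∫ z in (-u)..(-u + t), κ z ^ 2 := by
      rw [intervalIntegral.integral_of_le hle, intervalIntegral.integral_of_le hle]
      exact setIntegral_congr_fun measurableSet_Ioc fun z hz => indicator_of_mem (hsub hz) _
    rw [h4, h5]
    simpa using h3

theorem half_mul_le_integral {f : ℝ → ℝ} (hf : Integrable f) (h0 : ∀ u, 0 ≤ f u) {c : ℝ}
    (hc : ∀ u ∈ Ioo (0 : ℝ) (1 / 2), c ≤ f u) : 1 / 2 * c ≤ ∫ u, f u := by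
  have h1 : ∫ _ in Ioo (0 : ℝ) (1 / 2), c ≤ ∫ u in Ioo (0 : ℝ) (1 / 2), f u :=
    setIntegral_mono_on (by simp) hf.integrableOn measurableSet_Ioo hc
  have h2 : ∫ _ in Ioo (0 : ℝ) (1 / 2), c = 1 / 2 * c := by
    rw [setIntegral_const, Real.volume_real_Ioo]
    norm_num
  rw [← h2]
  exact h1.trans (setIntegral_le_integral hf (.of_forall h0))

/-- On `(0, 1/2)` the past term vanishes and `1 - u` stays above `1/2`, so the bound is a positive
constant. -/
theorem IsSonineKernel.chi_half_le (h : IsSonineKernel ν κ) {u : ℝ} (hu : u ∈ Ioo (0 : ℝ) (1 / 2)) :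
    chi κ (1 / 2) ≤ chiIncrement κ 1 u := by
  rw [chiIncrement, max_eq_left (by linarith [hu.2]), max_eq_right (by linarith [hu.1]), chi_zero,
    sub_zero]
  exact h.chi_mono (by norm_num) (by linarith [hu.2])

theorem IsSonineKernel.normConst_pos (h : IsSonineKernel ν κ) (hB1 : ConditionB1 κ) :
    0 < normConst κ := by
  have hp := h.chi_pos (t := 1 / 2) (by norm_num)
  refine inv_pos.2 (lt_of_lt_of_le ?_ (half_mul_le_integral
    (h.memLp_chiIncrement hB1 zero_le_one).integrable_sq (fun _ => sq_nonneg _)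
    fun u hu => pow_le_pow_left₀ hp.le (h.chi_half_le hu) 2))
  positivity

theorem IsSonineKernel.memLp_mvnKernel (h : IsSonineKernel ν κ) (hB1 : ConditionB1 κ)
    {t : ℝ} (ht : 0 ≤ t) : MemLp (mvnKernel κ t) 2 volume :=
  (h.memLp_chiIncrement hB1 ht).const_mul _

theorem IsSonineKernel.le_integral_mvnKernel (h : IsSonineKernel ν κ) (hB1 : ConditionB1 κ)
    {t : ℝ} (ht : 0 ≤ t) :
    normConst κ * (1 / 2 * (chi κ (1 / 2) * (chi κ t - chi κ 1)))
      ≤ (∫ u, mvnKernel κ 1 u * mvnKernel κ (t + 1) u)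
        - ∫ u, mvnKernel κ 1 u * mvnKernel κ 1 u := by
  have h1 := h.memLp_mvnKernel hB1 zero_le_one
  have ht1 := h.memLp_mvnKernel hB1 (t := t + 1) (by linarith)
  have hc1 := h.memLp_chiIncrement hB1 zero_le_one
  have hct := h.memLp_chiIncrement hB1 (t := t + 1) (by linarith)
  have hC := h.normConst_pos hB1
  have hsub := integral_sub (h1.integrable_mul ht1) (h1.integrable_mul h1)
  simp only [Pi.mul_apply] at hsub
  rw [← hsub]
  have heq : ∀ u, mvnKernel κ 1 u * mvnKernel κ (t + 1) u - mvnKernel κ 1 u * mvnKernel κ 1 u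
      = normConst κ * (chiIncrement κ 1 u * (chiIncrement κ (t + 1) u - chiIncrement κ 1 u)) := by
    intro u
    simp only [mvnKernel]
    linear_combination (chiIncrement κ 1 u * (chiIncrement κ (t + 1) u - chiIncrement κ 1 u))
      * Real.mul_self_sqrt hC.le
  have hnn : ∀ u, 0 ≤ chiIncrement κ (t + 1) u - chiIncrement κ 1 u := fun u =>
    sub_nonneg.2 (h.chiIncrement_mono (by linarith) u)
  have hlow := half_mul_le_integral (hc1.integrable_mul (hct.sub hc1))
    (c := chi κ (1 / 2) * (chi κ t - chi κ 1))
    (fun u => mul_nonneg (h.chiIncrement_nonneg zero_le_one u) (hnn u)) fun u hu => by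
      have e1 := h.chi_half_le hu
      -- For `0 < u < 1/2` one has `t + 1 - u ≥ t` and `1 - u ≤ 1`.
      have e2 : chi κ t - chi κ 1 ≤ chiIncrement κ (t + 1) u - chiIncrement κ 1 u := by
        have hu1 := hu.1
        have hu2 := hu.2
        have a1 : chi κ t ≤ chi κ (max (t + 1 - u) 0) :=
          h.chi_mono ht (le_max_of_le_left (by linarith))
        have a2 : chi κ (max (1 - u) 0) ≤ chi κ 1 :=
          h.chi_mono (le_max_right _ _) (max_le (by linarith) zero_le_one)
        unfold chiIncrement
        linarith
      have e3 := h.chi_nonneg (a := 1 / 2) (by norm_num)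
      exact (mul_le_mul_of_nonneg_left e2 e3).trans (mul_le_mul_of_nonneg_right e1 (hnn u))
  simp_rw [heq]
  rw [integral_const_mul]
  exact mul_le_mul_of_nonneg_left hlow hC.le

end Kernel

/-! ### Memory -/

section Memory

variable {Ω : Type*} [MeasurableSpace Ω] {P : Measure Ω}

/-- The increments telescope from time `1`, the left end for `n = 1`, to time `N + 1`. -/
theorem sum_rho {B : ℝ → Ω → ℝ} (hB : ∀ t, 0 ≤ t → MemLp (B t) 2 P) (N : ℕ) :
    ∑ n ∈ Finset.Icc 1 N, rho P B n
      = (∫ ω, B 1 ω * B ((N : ℝ) + 1) ω ∂P) - ∫ ω, B 1 ω * B 1 ω ∂P := by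
  induction N with
  | zero => simp
  | succ N ih =>
    rw [Finset.sum_Icc_succ_top (by omega), ih, rho]
    have hi : ∀ t, 0 ≤ t → Integrable (fun ω => B 1 ω * B t ω) P := fun t ht =>
      (hB 1 zero_le_one).integrable_mul (hB t ht)
    simp_rw [mul_sub]
    rw [integral_sub (hi _ (by positivity)) (hi _ (by positivity))]
    push_cast
    ring

/-- Absolute summability would make the partial sums converge. -/
theorem isLongRangeDependent_of_tendsto {B : ℝ → Ω → ℝ}
    (h : Tendsto (fun N : ℕ => ∑ n ∈ Finset.Icc 1 N, rho P B n) atTop atTop) :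
    IsLongRangeDependent P B := by
  intro hs
  have h1 := hs.of_abs.hasSum.tendsto_sum_nat
  refine not_tendsto_nhds_of_tendsto_atTop (h.congr fun N => ?_) _ h1
  rw [Finset.range_eq_Ico, Finset.sum_Ico_add' (fun n => rho P B n) 0 N 1]
  rfl

end Memory

end BGM


theorem mainTheorem4 {Ω : Type*} [MeasurableSpace Ω] (P : MeasureTheory.Measure Ω)
    [MeasureTheory.IsProbabilityMeasure P]
    (W : ℝ → Ω → ℝ) (hW : BGM.IsTwoSidedWiener W P)
    (φ m κ : ℝ → ℝ)
    (hφ : BGM.IsCompleteBernstein φ m) (hC : BGM.ConditionC φ) (hK : BGM.ConditionK φ)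
    (hκ : BGM.IsSonineKernel (BGM.levyTail m) κ)
    (hB1 : BGM.ConditionB1 κ) (hB2 : BGM.ConditionB2 κ) :
    (∀ t : ℝ, 0 ≤ t →
      BGM.IsWienerIntegral P W (BGM.mvnKernel κ t) (BGM.processB P W κ t)) ∧
    Filter.Tendsto (fun N : ℕ => ∑ n ∈ Finset.Icc 1 N, BGM.rho P (BGM.processB P W κ) n)
      Filter.atTop Filter.atTop ∧
    BGM.IsLongRangeDependent P (BGM.processB P W κ) := by
  have hB : ∀ t : ℝ, 0 ≤ t →
      BGM.IsWienerIntegral P W (BGM.mvnKernel κ t) (BGM.processB P W κ t) := fun t ht =>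
    BGM.isWienerIntegral_wienerIntegral hW (hκ.memLp_mvnKernel hB1 ht)
  have hsum : Filter.Tendsto
      (fun N : ℕ => ∑ n ∈ Finset.Icc 1 N, BGM.rho P (BGM.processB P W κ) n)
      Filter.atTop Filter.atTop := by
    -- The lower bound on the partial sums diverges: positive constants times `χ(N) - χ(1)`.
    have hχ : Filter.Tendsto (fun N : ℕ => BGM.normConst κ *
        (1 / 2 * (BGM.chi κ (1 / 2) * (BGM.chi κ N - BGM.chi κ 1)))) Filter.atTop Filter.atTop :=
      (((Filter.tendsto_atTop_add_const_right _ (-BGM.chi κ 1)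
        ((hφ.tendsto_chi hκ).comp tendsto_natCast_atTop_atTop)).const_mul_atTop
          (hκ.chi_pos (by norm_num))).const_mul_atTop (by norm_num)).const_mul_atTop
            (hκ.normConst_pos hB1)
    refine Filter.tendsto_atTop_mono (fun N => ?_) hχ
    have h1 := hB 1 zero_le_one
    rw [BGM.sum_rho (fun t ht => (hB t ht).memLp), h1.integral_mul hW (hB _ (by positivity)),
      h1.integral_mul hW h1]
    exact hκ.le_integral_mvnKernel hB1 N.cast_nonneg
  exact ⟨hB, hsum, BGM.isLongRangeDependent_of_tendsto hsum⟩
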